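/- Links are unoriented links in $S^3$, given by diagrams up to isotopy (planar isotopy and Reidemeister moves). A $5$-move replaces two parallel arcs of a link diagram by five half twists (of either handedness), and two links are $5$-move equivalent if one is obtained from the other by finitely many $5$-moves, their inverses and isotopies. For coprime integers $p,q$, a rational link of type $\frac{p}{q}$ is the numerator closure of Conway's rational tangle $[\frac{p}{q}]$ (with $[\frac10]=[\infty]$). **Corollary 2.12.** Let $p,q$ be coprime integers. A rational link of type $\frac{p}{q}$ is (i) $5$-move equivalent to the trivial link $T_2$ of two components if and only if $p\equiv 0 \pmod 5$ and $q\equiv \pm 1 \pmod 5$; (ii) $5$-move equivalent to the figure eight knot $4_1$ if and only if $p\equiv 0 \pmod 5$ and $q\equiv \pm 2 \pmod 5$; (iii) $5$-move equivalent to the trivial knot $T_1$ if and only if $p\equiv \pm 1 \pmod 5$; (iv) $5$-move equivalent to the Hopf link $H$ if and only if $p\equiv \pm 2 \pmod 5$. -/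

import Mathlib

/-! # Unoriented link diagrams, 5-moves and rational links

Links are treated diagrammatically: a link is a link diagram in the plane up to planar isotopy and
the three Reidemeister moves.  A planar diagram is put in general position with respect to the
height function and cut into horizontal slices, each of which contains a single local minimum, a
single local maximum or a single crossing, all other strands being vertical.  Reading the slices
from bottom to top, a diagram is a finite list of events.  Two sliced diagrams present isotopic
tangles if and only if they are related by the local replacements listed in `IsotopyMove` below. -/

namespace FiveMove

/-- What happens in a slice: a local minimum (`cup`), a local maximum (`cap`) or a crossing of two
neighbouring strands.  In `cross true` the overcrossing strand runs from bottom left to top right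
(positive slope), in `cross false` it runs from bottom right to top left (negative slope). -/
inductive Shape where
  | cup : Shape
  | cap : Shape
  | cross (b : Bool) : Shape

/-- Number of strands that enter an event from below. -/
def Shape.inputs : Shape → ℕ
  | .cup => 0
  | .cap => 2
  | .cross _ => 2

/-- Number of strands that leave an event at the top. -/
def Shape.outputs : Shape → ℕ
  | .cup => 2
  | .cap => 0
  | .cross _ => 2

/-- An elementary slice: the event `shape` with exactly `pos` vertical strands to its left. -/
structure Event where
  shape : Shape
  pos : ℕ

def cup (i : ℕ) : Event := ⟨.cup, i⟩

def cap (i : ℕ) : Event := ⟨.cap, i⟩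

def cross (b : Bool) (i : ℕ) : Event := ⟨.cross b, i⟩

/-- The number of strands above the event if there are `n` strands below it; `none` if the event
does not fit on `n` strands. -/
def Event.widthAbove (n : ℕ) (e : Event) : Option ℕ :=
  if e.pos + e.shape.inputs ≤ n then some (n - e.shape.inputs + e.shape.outputs) else none

/-- The number of strands above a list of slices (read from bottom to top) if there are `n` strands
below it; `none` if the slices do not fit together. -/
def widthAbove : ℕ → List Event → Option ℕ
  | n, [] => some n
  | n, e :: w => (e.widthAbove n).bind fun k => widthAbove k w

theorem widthAbove_append (n : ℕ) (u v : List Event) :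
    widthAbove n (u ++ v) = (widthAbove n u).bind fun k => widthAbove k v := by
  induction u generalizing n with
  | nil => rfl
  | cons e u ih =>
    simp only [List.cons_append, widthAbove]
    cases e.widthAbove n with
    | none => rfl
    | some k => simpa using ih k

/-- A (sliced, unoriented) tangle diagram with `m` endpoints at the bottom and `n` at the top. -/
structure TangleDiagram (m n : ℕ) where
  word : List Event
  fits : widthAbove m word = some n

/-- A link diagram is a tangle diagram without endpoints. -/
abbrev LinkDiagram : Type := TangleDiagram 0 0

/-- Stacking the diagram `E` on top of the diagram `D`. -/
def TangleDiagram.stack {l m n : ℕ} (D : TangleDiagram l m) (E : TangleDiagram m n) :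
    TangleDiagram l n where
  word := D.word ++ E.word
  fits := by rw [widthAbove_append, D.fits]; exact E.fits

/-- The local replacements that generate isotopy of tangles: planar isotopy and Reidemeister
moves. -/
inductive IsotopyMove : List Event → List Event → Prop
  /-- Planar isotopy: two events lying side by side exchange their heights. -/
  | exchange (s t : Shape) (i k : ℕ) (h : i ≤ k) :
      IsotopyMove [⟨s, i⟩, ⟨t, k + s.outputs⟩] [⟨t, k + s.inputs⟩, ⟨s, i⟩]
  /-- Planar isotopy: straightening a strand. -/
  | zigzagLeft (i : ℕ) : IsotopyMove [cup (i + 1), cap i] []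
  | zigzagRight (i : ℕ) : IsotopyMove [cup i, cap (i + 1)] []
  /-- Planar isotopy: turning a crossing past a local minimum or a local maximum. -/
  | turnCup (b : Bool) (i : ℕ) :
      IsotopyMove [cup i, cross b (i + 1)] [cup (i + 1), cross (!b) i]
  | turnCap (b : Bool) (i : ℕ) :
      IsotopyMove [cross b (i + 1), cap i] [cross (!b) i, cap (i + 1)]
  /-- First Reidemeister move. -/
  | reidemeisterOneCup (b : Bool) (i : ℕ) : IsotopyMove [cup i, cross b i] [cup i]
  | reidemeisterOneCap (b : Bool) (i : ℕ) : IsotopyMove [cross b i, cap i] [cap i]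
  /-- Second Reidemeister move. -/
  | reidemeisterTwo (b : Bool) (i : ℕ) : IsotopyMove [cross b i, cross (!b) i] []
  /-- Third Reidemeister move. -/
  | reidemeisterThree (b : Bool) (i : ℕ) :
      IsotopyMove [cross b i, cross b (i + 1), cross b i]
        [cross b (i + 1), cross b i, cross b (i + 1)]

/-- The (±)5-move: two parallel strands, neighbouring in a slice, receive five half twists (of
either handedness). -/
inductive FiveTwist : List Event → List Event → Prop
  | twist (b : Bool) (i : ℕ) : FiveTwist [] (List.replicate 5 (cross b i))

/-- `E` arises from `D` by one local replacement allowed by `R`. -/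
def Replaces (R : List Event → List Event → Prop) {m n : ℕ} (D E : TangleDiagram m n) : Prop :=
  ∃ u a b v : List Event, R a b ∧ D.word = u ++ a ++ v ∧ E.word = u ++ b ++ v

/-- Two diagrams present isotopic tangles (for link diagrams: the same link). -/
def Isotopic {m n : ℕ} : TangleDiagram m n → TangleDiagram m n → Prop :=
  Relation.EqvGen (Replaces IsotopyMove)

/-- 5-move equivalence: the diagrams are connected by finitely many isotopies and 5-moves or their
inverses. -/
def FiveMoveEquiv {m n : ℕ} : TangleDiagram m n → TangleDiagram m n → Prop :=
  Relation.EqvGen fun D E => Replaces IsotopyMove D E ∨ Replaces FiveTwist D E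

/-! ## Rational tangles and links

The four endpoints SW, NW, NE, SE of a 2-tangle, in clockwise order, are pulled up to the positions
0, 1, 2, 3 at the top of the diagram. -/

/-- The tangle `[∞]`: the arcs SW–NW and NE–SE. -/
def tangleInfinity : TangleDiagram 0 4 := ⟨[cup 0, cup 2], rfl⟩

/-- The tangle `[0]`: the arcs SW–SE and NW–NE. -/
def tangleZero : TangleDiagram 0 4 := ⟨[cup 0, cup 1], rfl⟩

/-- Adds the tangle `[1]` (if `s = true`) or `[-1]` (if `s = false`) on the right, which is a half
twist of the ends NE and SE.  In the crossing `[1]` the overcrossing strand has positive slope when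
the ends NE and SE point to the right; once they have been turned to point upwards it has negative
slope. -/
def horizontalTwist (s : Bool) : TangleDiagram 4 4 := ⟨[cross (!s) 2], rfl⟩

/-- Multiplies by the vertical tangle `[1]` (if `s = true`) or `[-1]` (if `s = false`) on the top,
which is a half twist of the ends NW and NE. -/
def verticalTwist (s : Bool) : TangleDiagram 4 4 := ⟨[cross s 1], rfl⟩

/-- The sign `1` or `-1`. -/
def sign (s : Bool) : ℤ := if s then 1 else -1

/-- `T` is a diagram, built by Conway's procedure, of the rational tangle with fraction `p / q`
(where `1 / 0 = ∞`).  A horizontal twist changes the fraction `f` to `f ± 1`, and a vertical twist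
changes it to `1 / (1 / f ± 1)`. -/
inductive IsRationalTangle : TangleDiagram 0 4 → ℤ → ℤ → Prop
  | infinity : IsRationalTangle tangleInfinity 1 0
  | zero : IsRationalTangle tangleZero 0 1
  | horizontal {T : TangleDiagram 0 4} {p q : ℤ} (s : Bool) (h : IsRationalTangle T p q) :
      IsRationalTangle (T.stack (horizontalTwist s)) (p + sign s * q) q
  | vertical {T : TangleDiagram 0 4} {p q : ℤ} (s : Bool) (h : IsRationalTangle T p q) :
      IsRationalTangle (T.stack (verticalTwist s)) p (q + sign s * p)

/-- The numerator of a 2-tangle: NW is joined to NE, and SW to SE. -/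
def numerator (T : TangleDiagram 0 4) : LinkDiagram :=
  T.stack ⟨[cap 1, cap 0], rfl⟩

/-- `L` is a diagram of a rational link of type `p / q` (for coprime `p` and `q`): up to isotopy it
is the numerator of a rational tangle whose fraction is `p / q = (-p) / (-q)`. -/
def IsRationalLink (L : LinkDiagram) (p q : ℤ) : Prop :=
  ∃ T : TangleDiagram 0 4,
    (IsRationalTangle T p q ∨ IsRationalTangle T (-p) (-q)) ∧ Isotopic L (numerator T)

/-! ## The four links -/

/-- The trivial knot: a round circle. -/
def trivialKnot : LinkDiagram := ⟨[cup 0, cap 0], rfl⟩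

/-- The trivial link of two components: two circles, one above the other. -/
def trivialLinkTwo : LinkDiagram := ⟨[cup 0, cap 0, cup 0, cap 0], rfl⟩

/-- The Hopf link: two circles side by side, clasped by two crossings. -/
def hopfLink : LinkDiagram :=
  ⟨[cup 0, cup 2, cross true 1, cross true 1, cap 0, cap 0], rfl⟩

/-- The figure eight knot `4₁`: the alternating diagram with four crossings whose Conway notation
is `2 2`. -/
def figureEight : LinkDiagram :=
  ⟨[cup 0, cup 2, cross true 1, cross true 1, cross false 2, cross false 2, cap 1, cap 0], rfl⟩

end FiveMove

namespace FiveMove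

/-! ## The Kauffman bracket at a root of unity

The variable `A = 5` of the Kauffman bracket satisfies `A ^ 20 = -1` in the field `ZMod 241`.  Events
act on functions of an infinite sequence of spins, so that the number of strands plays no role. -/

/-! The theorem has two halves: every rational link reduces to one of the four links, and an
invariant shows that these four are inequivalent.

Reduction: the half twists of tangle ends act on tangles modulo 5-moves as permutations `h`, `v`.
They satisfy a braid relation and `h ^ 5 = 1`, and they act on `[0]` and `[∞]` by isotopy
(`twistRelations`). These relations alone make the orbit a quotient of the nonzero vectors of `(ZMod
5)²` up to sign (`TwistRelations.h_slopePoint`, `TwistRelations.v_slopePoint`), so a rational tangle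
depends only on its slope modulo 5. The numerator absorbs vertical twists, which leaves four cases
(`numeratorClass_rationalClass_eq`).

Separation: at `A ^ 20 = -1` five half twists act as the scalar `A ^ (±5)` (`cross_pow_five`), and
Reidemeister I gives `-A ^ (±3)`. Both are 40th roots of unity, so the 40th power of the Kauffman
bracket is a 5-move invariant. With `A = 5` and `A⁻¹ = 193` in `ZMod 241` it takes four distinct
values. -/

/-- The field in which the Kauffman bracket takes its values. -/
abbrev BracketField : Type := ZMod 241

/-- Functions of the spins of infinitely many strands. -/
abbrev SpinFunction : Type := Stream' Bool → BracketField

/-- The value of a circle in the Kauffman bracket. -/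
def circleValue : BracketField := -(5 ^ 2 + 193 ^ 2)

/-- A local minimum on the two leftmost strands. -/
def cupOperator : Module.End BracketField SpinFunction where
  toFun f s := (bif s.head then bif s.tail.head then 0 else -5 ^ 2
    else bif s.tail.head then 1 else 0) * f s.tail.tail
  map_add' f g := by ext s; simp [mul_add]
  map_smul' c f := by ext s; simp [mul_left_comm]

/-- A local maximum on the two leftmost strands. -/
def capOperator : Module.End BracketField SpinFunction where
  toFun f s := -193 ^ 2 * f (Stream'.cons false (Stream'.cons true s)) +
    f (Stream'.cons true (Stream'.cons false s))
  map_add' f g := by ext s; simp; ring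
  map_smul' c f := by ext s; simp; ring

/-- Adding a vertical strand on the left. -/
def shiftOperator : Module.End BracketField SpinFunction →ₐ[BracketField]
    Module.End BracketField SpinFunction where
  toFun T :=
    { toFun := fun f s => T (fun r => f (Stream'.cons s.head r)) s.tail
      map_add' := fun f g => by
        ext s
        exact congrFun (T.map_add (fun r => f (Stream'.cons s.head r))
          (fun r => g (Stream'.cons s.head r))) s.tail
      map_smul' := fun c f => by
        ext s
        exact congrFun (T.map_smul c (fun r => f (Stream'.cons s.head r))) s.tail }
  map_one' := by ext f s; simp [Stream'.eta]
  map_mul' S T := by ext f s; simp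
  map_zero' := by ext f s; simp
  map_add' S T := by ext f s; simp
  commutes' c := by ext f s; simp [Module.algebraMap_end_apply, Stream'.eta]

/-- The Temperley-Lieb generator on the two leftmost strands. -/
def hookOperator : Module.End BracketField SpinFunction := cupOperator * capOperator

/-- The Kauffman bracket of a crossing of the two leftmost strands. -/
def crossOperator (b : Bool) : Module.End BracketField SpinFunction :=
  bif b then (5 : BracketField) • 1 + (193 : BracketField) • hookOperator
  else (193 : BracketField) • 1 + (5 : BracketField) • hookOperator

/-- The action of an event on the leftmost strands. -/
def shapeOperator : Shape → Module.End BracketField SpinFunction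
  | .cup => cupOperator
  | .cap => capOperator
  | .cross b => crossOperator b

/-- The action of an event. -/
def eventOperator (e : Event) : Module.End BracketField SpinFunction :=
  (shiftOperator ^ e.pos) (shapeOperator e.shape)

/-- The Kauffman bracket of a list of events. -/
def bracket : List Event → Module.End BracketField SpinFunction
  | [] => 1
  | e :: w => bracket w * eventOperator e

/-! ### Planar isotopy for the operators: circles, zigzags, far commutation -/

theorem bracket_append (u w : List Event) : bracket (u ++ w) = bracket w * bracket u := by
  induction u with
  | nil => simp [bracket]
  | cons e u ih => simp [bracket, ih, mul_assoc]

theorem capOperator_mul_cupOperator :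
    capOperator * cupOperator = circleValue • (1 : Module.End BracketField SpinFunction) := by
  ext f s
  simp [capOperator, cupOperator, circleValue]
  ring

/-- The cup weights `1`, `-A²` and the cap weights `-A⁻²`, `1` are matched so that zigzags
straighten exactly, while a circle gives `-A² - A⁻²`. -/
theorem capOperator_mul_shift_cupOperator : capOperator * shiftOperator cupOperator = 1 := by
  ext f s
  obtain ⟨a, s, rfl⟩ : ∃ a r, s = Stream'.cons a r := ⟨_, _, (Stream'.eta s).symm⟩
  have h : (193 : BracketField) ^ 2 * 5 ^ 2 = 1 := by decide
  cases a <;> simp [capOperator, cupOperator, shiftOperator]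
  linear_combination (f (Stream'.cons false s)) * h

theorem shift_capOperator_mul_cupOperator : shiftOperator capOperator * cupOperator = 1 := by
  ext f s
  obtain ⟨a, s, rfl⟩ : ∃ a r, s = Stream'.cons a r := ⟨_, _, (Stream'.eta s).symm⟩
  have h : (193 : BracketField) ^ 2 * 5 ^ 2 = 1 := by decide
  cases a <;> simp [capOperator, cupOperator, shiftOperator]
  linear_combination (f (Stream'.cons true s)) * h

theorem shift_shift_mul_cupOperator (T : Module.End BracketField SpinFunction) :
    shiftOperator (shiftOperator T) * cupOperator = cupOperator * T := by
  ext f s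
  exact congrFun (T.map_smul (bif s.head then bif s.tail.head then 0 else -5 ^ 2
    else bif s.tail.head then 1 else 0) f) s.tail.tail

theorem shift_shift_comm_capOperator (T : Module.End BracketField SpinFunction) :
    T * capOperator = capOperator * shiftOperator (shiftOperator T) := by
  ext f s
  simp only [Module.End.mul_apply]
  have : capOperator f = (-193 ^ 2 : BracketField) •
      (fun s => f (Stream'.cons false (Stream'.cons true s))) +
      fun s => f (Stream'.cons true (Stream'.cons false s)) := rfl
  rw [this, map_add, map_smul]
  rfl

theorem shift_shift_comm_hookOperator (T : Module.End BracketField SpinFunction) :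
    shiftOperator (shiftOperator T) * hookOperator =
      hookOperator * shiftOperator (shiftOperator T) := by
  rw [hookOperator, ← mul_assoc, shift_shift_mul_cupOperator, mul_assoc,
    shift_shift_comm_capOperator, mul_assoc]

theorem shift_pow_succ (k : ℕ) (T : Module.End BracketField SpinFunction) :
    (shiftOperator ^ (k + 1)) T = (shiftOperator ^ k) (shiftOperator T) := by
  rw [pow_succ]; rfl

theorem shift_pow_add (j k : ℕ) (T : Module.End BracketField SpinFunction) :
    (shiftOperator ^ (j + k)) T = (shiftOperator ^ j) ((shiftOperator ^ k) T) := by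
  rw [pow_add]; rfl

theorem shift_two (T : Module.End BracketField SpinFunction) :
    (shiftOperator ^ 2) T = shiftOperator (shiftOperator T) := rfl

/-- An event to the right of `s` does not see the strands of `s`; only its position changes, from
`s.inputs` to `s.outputs`. This is the exchange move. -/
theorem shift_comm_shapeOperator (s : Shape) (T : Module.End BracketField SpinFunction) :
    (shiftOperator ^ s.outputs) T * shapeOperator s =
      shapeOperator s * (shiftOperator ^ s.inputs) T := by
  cases s with
  | cup => exact shift_shift_mul_cupOperator T
  | cap => exact shift_shift_comm_capOperator T
  | cross b =>
    simp only [Shape.outputs, Shape.inputs, shapeOperator, shift_two]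
    cases b <;> simp [crossOperator, mul_add, add_mul, shift_shift_comm_hookOperator]

/-! ### Temperley-Lieb relations and their consequences for crossings -/

theorem hookOperator_mul_self : hookOperator * hookOperator = circleValue • hookOperator := by
  rw [hookOperator, mul_assoc, ← mul_assoc capOperator, capOperator_mul_cupOperator]
  simp

theorem hook_shift_hook : hookOperator * shiftOperator hookOperator * hookOperator =
    hookOperator := by
  simp only [hookOperator, map_mul]
  calc _ = cupOperator * (capOperator * shiftOperator cupOperator) *
        (shiftOperator capOperator * cupOperator) * capOperator := by simp only [mul_assoc]
    _ = _ := by rw [capOperator_mul_shift_cupOperator, shift_capOperator_mul_cupOperator]; simp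

theorem shift_hook_shift : shiftOperator hookOperator * hookOperator * shiftOperator hookOperator =
    shiftOperator hookOperator := by
  simp only [hookOperator, map_mul]
  calc _ = shiftOperator cupOperator * (shiftOperator capOperator * cupOperator) *
        (capOperator * shiftOperator cupOperator) * shiftOperator capOperator := by
          simp only [mul_assoc]
    _ = _ := by rw [capOperator_mul_shift_cupOperator, shift_capOperator_mul_cupOperator]; simp

theorem cross_braid_relation (b : Bool) :
    crossOperator b * shiftOperator (crossOperator b) * crossOperator b =
      shiftOperator (crossOperator b) * crossOperator b * shiftOperator (crossOperator b) := by
  have h1 := hookOperator_mul_self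
  have h1s := congrArg shiftOperator h1
  have h2 := hook_shift_hook
  have h3 := shift_hook_shift
  rw [map_mul, map_smul] at h1s
  cases b <;>
  · simp only [crossOperator, cond_true, cond_false, map_add, map_smul, map_one, mul_add, add_mul,
      smul_mul_assoc, mul_smul_comm, one_mul, mul_one, h1, h1s, h2, h3, smul_smul, circleValue]
    match_scalars <;> decide

theorem cross_mul_cross (b : Bool) : crossOperator (!b) * crossOperator b = 1 := by
  cases b <;>
  · simp only [crossOperator, cond_true, cond_false, Bool.not_true, Bool.not_false, mul_add,
      add_mul, smul_mul_assoc, mul_smul_comm, one_mul, mul_one, hookOperator_mul_self, circleValue]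
    match_scalars <;> decide

/-- A crossing has eigenvalues `A` and `A + A⁻¹δ = -A⁻³` (for `b = true`), where `δ` is the circle
value. Their ratio `-A⁻⁴` has fifth power `-A⁻²⁰ = 1`. -/
theorem cross_pow_five (b : Bool) :
    crossOperator b ^ 5 = (bif b then (5 ^ 5 : BracketField) else 193 ^ 5) •
      (1 : Module.End BracketField SpinFunction) := by
  cases b <;>
  · simp only [crossOperator, cond_true, cond_false, mul_add, pow_succ, pow_zero,
      add_mul, smul_mul_assoc, mul_smul_comm, one_mul, mul_one, hookOperator_mul_self, circleValue]
    match_scalars <;> decide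

theorem cross_mul_cupOperator (b : Bool) :
    crossOperator b * cupOperator = (bif b then (-193 ^ 3 : BracketField) else -5 ^ 3) •
      cupOperator := by
  cases b <;>
  · simp only [crossOperator, cond_true, cond_false, hookOperator, add_mul, smul_mul_assoc,
      one_mul, mul_assoc, capOperator_mul_cupOperator, mul_smul_comm, mul_one, circleValue]
    match_scalars <;> decide

theorem capOperator_mul_cross (b : Bool) :
    capOperator * crossOperator b = (bif b then (-193 ^ 3 : BracketField) else -5 ^ 3) •
      capOperator := by
  cases b <;>
  · simp only [crossOperator, cond_true, cond_false, hookOperator, mul_add, smul_mul_assoc,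
      mul_one, ← mul_assoc, capOperator_mul_cupOperator, mul_smul_comm, one_mul, circleValue]
    match_scalars <;> decide

/-- Straightening zigzags exchanges the identity term and the hook term, which is the same as
switching the crossing. -/
theorem shift_cross_mul_cupOperator (b : Bool) :
    shiftOperator (crossOperator b) * cupOperator =
      crossOperator (!b) * shiftOperator cupOperator := by
  cases b <;>
  · simp only [crossOperator, cond_true, cond_false, Bool.not_true, Bool.not_false, hookOperator,
      map_add, map_smul, map_one, map_mul, add_mul, smul_mul_assoc, one_mul, mul_assoc,
      shift_capOperator_mul_cupOperator, capOperator_mul_shift_cupOperator, mul_one]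
    exact add_comm _ _

theorem capOperator_mul_shift_cross (b : Bool) :
    capOperator * shiftOperator (crossOperator b) =
      shiftOperator capOperator * crossOperator (!b) := by
  cases b <;>
  · simp only [crossOperator, cond_true, cond_false, Bool.not_true, Bool.not_false, hookOperator,
      map_add, map_smul, map_one, map_mul, mul_add, mul_smul_comm, mul_one, ← mul_assoc,
      shift_capOperator_mul_cupOperator, capOperator_mul_shift_cupOperator, one_mul]
    exact add_comm _ _

/-! ### Invariance under isotopy and 5-moves -/

/-- Equality of brackets up to a 40th root of unity. -/
def BracketEquiv (u w : List Event) : Prop :=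
  ∃ c : BracketField, c ^ 40 = 1 ∧ bracket w = c • bracket u

theorem BracketEquiv.refl (u : List Event) : BracketEquiv u u := ⟨1, by simp, by simp⟩

theorem BracketEquiv.symm {u w : List Event} (h : BracketEquiv u w) : BracketEquiv w u := by
  obtain ⟨c, hc, h⟩ := h
  -- `c ^ 39` is the inverse of `c`.
  refine ⟨c ^ 39, by rw [← pow_mul, mul_comm, pow_mul, hc, one_pow], ?_⟩
  rw [h, smul_smul, ← pow_succ, hc, one_smul]

theorem BracketEquiv.trans {u v w : List Event} (h : BracketEquiv u v) (h' : BracketEquiv v w) :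
    BracketEquiv u w := by
  obtain ⟨c, hc, h⟩ := h
  obtain ⟨d, hd, h'⟩ := h'
  exact ⟨d * c, by rw [mul_pow, hc, hd, one_mul], by rw [h', h, smul_smul]⟩

theorem BracketEquiv.append {a b : List Event} (h : BracketEquiv a b) (u v : List Event) :
    BracketEquiv (u ++ a ++ v) (u ++ b ++ v) := by
  obtain ⟨c, hc, h⟩ := h
  exact ⟨c, hc, by simp only [bracket_append, h, smul_mul_assoc, mul_smul_comm]⟩

theorem BracketEquiv.of_eq {a b : List Event} (h : bracket a = bracket b) : BracketEquiv a b :=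
  ⟨1, by simp, by simp [h]⟩

theorem BracketEquiv.of_isotopyMove {a b : List Event} (h : IsotopyMove a b) :
    BracketEquiv a b := by
  cases h with
  | exchange s t i k h =>
    obtain ⟨j, rfl⟩ := Nat.exists_eq_add_of_le h
    apply BracketEquiv.of_eq
    simp only [bracket, one_mul, eventOperator, add_assoc, shift_pow_add, ← map_mul]
    congr 1
    have := shift_comm_shapeOperator s ((shiftOperator ^ j) (shapeOperator t))
    simpa only [← shift_pow_add, add_comm j] using this
  | zigzagLeft i =>
    apply BracketEquiv.of_eq
    simp only [bracket, one_mul, eventOperator, cup, cap, shapeOperator, shift_pow_succ, ← map_mul,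
      capOperator_mul_shift_cupOperator, map_one]
  | zigzagRight i =>
    apply BracketEquiv.of_eq
    simp only [bracket, one_mul, eventOperator, cup, cap, shapeOperator, shift_pow_succ, ← map_mul,
      shift_capOperator_mul_cupOperator, map_one]
  | turnCup b i =>
    apply BracketEquiv.of_eq
    simp only [bracket, one_mul, eventOperator, cup, cross, shapeOperator, shift_pow_succ,
      ← map_mul, shift_cross_mul_cupOperator]
  | turnCap b i =>
    apply BracketEquiv.of_eq
    simp only [bracket, one_mul, eventOperator, cap, cross, shapeOperator, shift_pow_succ,
      ← map_mul, capOperator_mul_shift_cross]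
  | reidemeisterOneCup b i =>
    refine BracketEquiv.symm ⟨bif b then -193 ^ 3 else -5 ^ 3, by cases b <;> decide, ?_⟩
    simp only [bracket, one_mul, eventOperator, cup, cross, shapeOperator, ← map_mul,
      cross_mul_cupOperator, map_smul]
  | reidemeisterOneCap b i =>
    refine BracketEquiv.symm ⟨bif b then -193 ^ 3 else -5 ^ 3, by cases b <;> decide, ?_⟩
    simp only [bracket, one_mul, eventOperator, cap, cross, shapeOperator, ← map_mul,
      capOperator_mul_cross, map_smul]
  | reidemeisterTwo b i =>
    apply BracketEquiv.of_eq
    simp only [bracket, one_mul, eventOperator, cross, shapeOperator, ← map_mul, cross_mul_cross,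
      map_one]
  | reidemeisterThree b i =>
    apply BracketEquiv.of_eq
    simp only [bracket, one_mul, eventOperator, cross, shapeOperator, shift_pow_succ, ← map_mul,
      cross_braid_relation]

theorem BracketEquiv.of_fiveTwist {a b : List Event} (h : FiveTwist a b) : BracketEquiv a b := by
  cases h with
  | twist b i =>
    refine ⟨bif b then 5 ^ 5 else 193 ^ 5, by cases b <;> decide, ?_⟩
    have h : crossOperator b * (crossOperator b * (crossOperator b *
        (crossOperator b * crossOperator b))) = _ :=
      (by simp only [pow_succ, pow_zero, one_mul, mul_assoc] :
        _ = crossOperator b ^ 5).trans (cross_pow_five b)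
    simp only [List.replicate, bracket, eventOperator, cross, shapeOperator, ← map_mul, one_mul,
      mul_assoc, h, map_smul, map_one]

/-- Up to 40th roots of unity, the Kauffman bracket is invariant under 5-moves. -/
theorem FiveMoveEquiv.bracketEquiv {m n : ℕ} {D E : TangleDiagram m n} (h : FiveMoveEquiv D E) :
    BracketEquiv D.word E.word := by
  induction h with
  | rel D E h =>
    rcases h with ⟨u, a, b, v, h, hD, hE⟩ | ⟨u, a, b, v, h, hD, hE⟩
    · rw [hD, hE]; exact (BracketEquiv.of_isotopyMove h).append u v
    · rw [hD, hE]; exact (BracketEquiv.of_fiveTwist h).append u v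
  | refl D => exact .refl _
  | symm D E _ h => exact h.symm
  | trans D E F _ _ h h' => exact h.trans h'

/-! ### Values of the invariant on the four links -/

/-- A numerical 5-move invariant: the 40th power of a value of the Kauffman bracket. -/
def bracketInvariant (w : List Event) : BracketField :=
  (bracket w (fun _ => 1) (Stream'.const false)) ^ 40

theorem FiveMoveEquiv.bracketInvariant_eq {m n : ℕ} {D E : TangleDiagram m n}
    (h : FiveMoveEquiv D E) : bracketInvariant D.word = bracketInvariant E.word := by
  obtain ⟨c, hc, h⟩ := h.bracketEquiv
  simp [bracketInvariant, h, mul_pow, hc]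

theorem bracketInvariant_trivialKnot : bracketInvariant trivialKnot.word = 15 := by
  decide +kernel

theorem bracketInvariant_trivialLinkTwo : bracketInvariant trivialLinkTwo.word = 225 := by
  decide +kernel

theorem bracketInvariant_hopfLink : bracketInvariant hopfLink.word = 240 := by
  decide +kernel

/-- The Jones polynomial of `4₁` is `(t⁵ + 1) / (t² (t + 1))`, which vanishes at `t = A⁻⁴` because
`t⁵ = -1`. -/
theorem bracketInvariant_figureEight : bracketInvariant figureEight.word = 0 := by
  decide +kernel

/-! ## Rational tangles up to 5-moves -/

section RationalOrbit

variable {Q : Type*} (h v : Equiv.Perm Q) (zero inf : Q)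

theorem perm_apply_inv (f : Equiv.Perm Q) (x : Q) : f (f⁻¹ x) = x := f.apply_symm_apply x

theorem perm_inv_apply (f : Equiv.Perm Q) (x : Q) : f⁻¹ (f x) = x := f.symm_apply_apply x

/-- The half turn, which replaces a slope by its negative inverse. -/
def halfTurn : Equiv.Perm Q := v * h⁻¹ * v

/-- The element of slope `1 / 2` modulo 5, shifted to slope `0 / 2`. -/
def halfPoint : Q := h (h (v (v inf)))

/-- The element of slope `x / y` modulo 5, in a set with a horizontal and a vertical twist. -/
def slopePoint (x y : ZMod 5) : Q :=
  if y = 0 then if x = 1 ∨ x = -1 then inf else halfTurn h v (halfPoint h v inf)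
  else (h ^ (x * y ^ 3).val) (if y = 1 ∨ y = -1 then zero else halfPoint h v inf)

/-- The relations between the half twists of rational tangles, modulo 5-moves. -/
structure TwistRelations : Prop where
  braid : v * h⁻¹ * v = h⁻¹ * v * h⁻¹
  h_pow : h ^ 5 = 1
  h_inf : h inf = inf
  v_zero : v zero = zero
  v_inf : v inf = h zero
  v_inv_inf : v⁻¹ inf = h⁻¹ zero

variable {h v zero inf}

/-! ### Consequences of the twist relations -/

namespace TwistRelations

/-- Rewriting one of the two copies of `halfTurn` by the braid relation makes the sides agree. Thus
`halfTurn` conjugates `v` to `h⁻¹`, and likewise `h` to `v⁻¹`, so no separate relation `v ^ 5 = 1`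
is needed. -/
theorem halfTurn_v (H : TwistRelations h v zero inf) (x : Q) :
    halfTurn h v (v x) = h⁻¹ (halfTurn h v x) := by
  have : halfTurn h v * v = h⁻¹ * halfTurn h v := by
    rw [halfTurn]
    nth_rw 1 [H.braid]
    simp only [mul_assoc]
  exact congrArg (· x) this

theorem halfTurn_v_inv (H : TwistRelations h v zero inf) (x : Q) :
    halfTurn h v (v⁻¹ x) = h (halfTurn h v x) := by
  have := H.halfTurn_v (v⁻¹ x)
  rw [perm_apply_inv] at this
  rw [this, perm_apply_inv]

theorem halfTurn_h_inv (H : TwistRelations h v zero inf) (x : Q) :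
    halfTurn h v (h⁻¹ x) = v (halfTurn h v x) := by
  have : halfTurn h v * h⁻¹ = v * halfTurn h v := by
    rw [halfTurn]
    nth_rw 2 [H.braid]
    simp only [mul_assoc]
  exact congrArg (· x) this

theorem halfTurn_h (H : TwistRelations h v zero inf) (x : Q) :
    halfTurn h v (h x) = v⁻¹ (halfTurn h v x) := by
  have := H.halfTurn_h_inv (h x)
  rw [perm_inv_apply] at this
  rw [this, perm_inv_apply]

theorem halfTurn_inf (H : TwistRelations h v zero inf) : halfTurn h v inf = zero := by
  rw [halfTurn, H.braid]
  have : h⁻¹ inf = inf := by rw [Equiv.Perm.inv_eq_iff_eq, H.h_inf]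
  simp only [Equiv.Perm.mul_apply, this, H.v_inf, perm_inv_apply]

theorem halfTurn_zero (H : TwistRelations h v zero inf) : halfTurn h v zero = inf := by
  simp only [halfTurn, Equiv.Perm.mul_apply, H.v_zero, ← H.v_inv_inf, perm_apply_inv]

theorem h_four (H : TwistRelations h v zero inf) (x : Q) : h (h (h (h x))) = h⁻¹ x := by
  rw [Equiv.Perm.eq_inv_iff_eq]
  exact congrArg (· x) H.h_pow

theorem h_two (H : TwistRelations h v zero inf) (x : Q) : h (h x) = h⁻¹ (h⁻¹ (h⁻¹ x)) := by
  rw [Equiv.Perm.eq_inv_iff_eq, Equiv.Perm.eq_inv_iff_eq, H.h_four]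

theorem h_three (H : TwistRelations h v zero inf) (x : Q) : h (h (h x)) = h⁻¹ (h⁻¹ x) := by
  rw [Equiv.Perm.eq_inv_iff_eq, H.h_four]

/-- The 5-move enters as `h² = h⁻³`: then `v h⁻³` is `h` times the braid word `h⁻¹ v h⁻¹`, followed
on the right by `h⁻²`. -/
theorem v_h_h (H : TwistRelations h v zero inf) (x : Q) :
    v (h (h x)) = h (v (v (halfTurn h v x))) := by
  have h1 : h (halfTurn h v (h⁻¹ (h⁻¹ x))) = v (h (h x)) := by
    rw [halfTurn, H.braid, H.h_two]
    simp only [Equiv.Perm.mul_apply, perm_apply_inv]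
  rw [← h1, H.halfTurn_h_inv, H.halfTurn_h_inv]

theorem v_v_h_inv_h_inv_zero (H : TwistRelations h v zero inf) :
    v (v (h⁻¹ (h⁻¹ zero))) = h (v (v inf)) := by
  have h1 : v (v (h⁻¹ (h⁻¹ zero))) = v (halfTurn h v (v⁻¹ (v⁻¹ inf))) := by
    rw [H.v_inv_inf]
    simp only [halfTurn, Equiv.Perm.mul_apply, perm_apply_inv]
  rw [h1, H.halfTurn_v_inv, H.halfTurn_v_inv, H.halfTurn_inf, H.v_h_h, H.halfTurn_zero]

theorem h_inv_v_v_inf (H : TwistRelations h v zero inf) : h⁻¹ (v (v inf)) = v⁻¹ (v⁻¹ inf) := by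
  rw [Equiv.Perm.eq_inv_iff_eq, Equiv.Perm.eq_inv_iff_eq]
  change v (halfTurn h v (v inf)) = inf
  rw [H.halfTurn_v, H.halfTurn_inf, ← H.v_inv_inf, perm_apply_inv]

theorem halfPoint_eq (H : TwistRelations h v zero inf) :
    halfPoint h v inf = h⁻¹ (h⁻¹ (v⁻¹ (v⁻¹ inf))) := by
  rw [halfPoint, H.h_two, H.h_inv_v_v_inf]

/-- Slope `0 / 2` is fixed by `v`, as `0 / 1` is. For `zero` this is an isotopy; here it depends on
`h ^ 5 = 1` through `v_h_h`. -/
theorem v_halfPoint (H : TwistRelations h v zero inf) :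
    v (halfPoint h v inf) = halfPoint h v inf := by
  rw [halfPoint, H.v_h_h, H.halfTurn_v, H.halfTurn_v, H.halfTurn_inf, H.v_v_h_inv_h_inv_zero]

theorem h_halfTurn_halfPoint (H : TwistRelations h v zero inf) :
    h (halfTurn h v (halfPoint h v inf)) = halfTurn h v (halfPoint h v inf) := by
  rw [← H.halfTurn_v_inv, (Equiv.Perm.inv_eq_iff_eq (f := v)).mpr H.v_halfPoint.symm]

theorem halfTurn_halfTurn_halfPoint (H : TwistRelations h v zero inf) :
    halfTurn h v (halfTurn h v (halfPoint h v inf)) = halfPoint h v inf := by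
  simp only [halfPoint, H.halfTurn_h, H.halfTurn_v, H.halfTurn_v_inv, H.halfTurn_h_inv,
    H.halfTurn_inf, H.halfTurn_zero]

/-- This and the next lemmas tabulate `halfTurn` on the `h`-orbits of `zero` and `halfPoint`: powers
of `h` are shortened modulo 5, then `halfTurn` is moved inwards to `zero` or `inf`. -/
theorem halfTurn_h_zero (H : TwistRelations h v zero inf) :
    halfTurn h v (h zero) = h (h (h (h zero))) := by
  rw [H.halfTurn_h, H.halfTurn_zero, H.v_inv_inf, H.h_four]

theorem halfTurn_h_h_zero (H : TwistRelations h v zero inf) :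
    halfTurn h v (h (h zero)) = h (h (halfPoint h v inf)) := by
  rw [H.halfTurn_h, H.halfTurn_h, H.halfTurn_zero, H.halfPoint_eq, perm_apply_inv,
    perm_apply_inv]

theorem halfTurn_h_h_h_zero (H : TwistRelations h v zero inf) :
    halfTurn h v (h (h (h zero))) = h (h (h (halfPoint h v inf))) := by
  rw [H.h_three, H.h_three, H.halfTurn_h_inv, H.halfTurn_h_inv, H.halfTurn_zero, halfPoint,
    perm_inv_apply, perm_inv_apply]

theorem halfTurn_h_h_h_h_zero (H : TwistRelations h v zero inf) :
    halfTurn h v (h (h (h (h zero)))) = h zero := by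
  rw [H.h_four, H.halfTurn_h_inv, H.halfTurn_zero, H.v_inf]

theorem halfTurn_h_halfPoint (H : TwistRelations h v zero inf) :
    halfTurn h v (h (halfPoint h v inf)) = h (h (h (h (halfPoint h v inf)))) := by
  rw [H.h_four, halfPoint, H.h_three, perm_inv_apply, H.halfTurn_h_inv,
    H.halfTurn_h_inv, H.halfTurn_v, H.halfTurn_v, H.halfTurn_inf, H.v_v_h_inv_h_inv_zero]

theorem halfTurn_h_h_halfPoint (H : TwistRelations h v zero inf) :
    halfTurn h v (h (h (halfPoint h v inf))) = h (h zero) := by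
  rw [H.halfPoint_eq, perm_apply_inv, perm_apply_inv, H.halfTurn_v_inv,
    H.halfTurn_v_inv, H.halfTurn_inf]

theorem halfTurn_h_h_h_halfPoint (H : TwistRelations h v zero inf) :
    halfTurn h v (h (h (h (halfPoint h v inf)))) = h (h (h zero)) := by
  rw [H.h_three, H.h_three, halfPoint, perm_inv_apply, perm_inv_apply,
    H.halfTurn_v, H.halfTurn_v, H.halfTurn_inf]

theorem halfTurn_h_h_h_h_halfPoint (H : TwistRelations h v zero inf) :
    halfTurn h v (h (h (h (h (halfPoint h v inf))))) = h (halfPoint h v inf) := by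
  rw [H.h_four, halfPoint, perm_inv_apply, ← H.v_v_h_inv_h_inv_zero, H.halfTurn_v,
    H.halfTurn_v, H.halfTurn_h_inv, H.halfTurn_h_inv, H.halfTurn_zero,
    H.v_v_h_inv_h_inv_zero, H.h_three]

/-- The pair `(0, 0)` is excluded because `slopePoint` gives it the default value of slope `2 / 0`,
which `halfTurn` sends to slope `0 / 2`. -/
theorem halfTurn_slopePoint (H : TwistRelations h v zero inf) (x y : ZMod 5)
    (hxy : ¬(x = 0 ∧ y = 0)) :
    halfTurn h v (slopePoint h v zero inf x y) = slopePoint h v zero inf (-y) x := by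
  fin_cases x <;> fin_cases y <;>
  first
  | exact absurd ⟨rfl, rfl⟩ hxy
  | exact H.halfTurn_inf
  | exact H.halfTurn_zero
  | exact H.halfTurn_h_zero
  | exact H.halfTurn_h_h_zero
  | exact H.halfTurn_h_h_h_zero
  | exact H.halfTurn_h_h_h_h_zero
  | exact H.halfTurn_h_halfPoint
  | exact H.halfTurn_h_h_halfPoint
  | exact H.halfTurn_h_h_h_halfPoint
  | exact H.halfTurn_h_h_h_h_halfPoint
  | exact H.halfTurn_halfTurn_halfPoint
  | rfl

theorem h_slopePoint (H : TwistRelations h v zero inf) (x y : ZMod 5) :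
    h (slopePoint h v zero inf x y) = slopePoint h v zero inf (x + y) y := by
  by_cases hy : y = 0
  · subst hy
    simp only [slopePoint, if_true, add_zero]
    split_ifs
    · exact H.h_inf
    · exact H.h_halfTurn_halfPoint
  · have h1 : (x + y) * y ^ 3 = x * y ^ 3 + 1 := by
      revert x y; decide
    have h2 (z : ZMod 5) : h ^ (z + 1).val = h * h ^ z.val := by
      rw [ZMod.val_add, ← pow_succ', ← pow_mod_orderOf h (z.val + 1),
        ← pow_mod_orderOf h (_ % 5), Nat.mod_mod_of_dvd _ (orderOf_dvd_of_pow_eq_one H.h_pow)]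
      rfl
    simp only [slopePoint, hy, if_false, h1, h2, Equiv.Perm.mul_apply]

theorem v_slopePoint (H : TwistRelations h v zero inf) (x y : ZMod 5)
    (hxy : ¬(x = 0 ∧ y = 0)) :
    v (slopePoint h v zero inf x y) = slopePoint h v zero inf x (y + x) := by
  -- Conjugation by `halfTurn` turns the claim into the one for `h`.
  apply (halfTurn h v).injective
  rw [H.halfTurn_v, H.halfTurn_slopePoint x y hxy, H.halfTurn_slopePoint x (y + x)
    (fun h => hxy ⟨h.1, by simpa [h.1] using h.2⟩), Equiv.Perm.inv_eq_iff_eq, H.h_slopePoint]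
  congr 1
  ring

end TwistRelations

theorem slopePoint_neg (x y : ZMod 5) :
    slopePoint h v zero inf (-x) (-y) = slopePoint h v zero inf x y := by
  have h1 : -x * (-y) ^ 3 = x * y ^ 3 := by ring
  simp only [slopePoint, h1, neg_eq_zero, neg_inj, neg_eq_iff_eq_neg (b := (1 : ZMod 5)), or_comm]

end RationalOrbit

/-! ## The classes of tangle diagrams modulo 5-moves -/

/-- Tangle diagrams modulo 5-move equivalence. -/
def TangleClass (m n : ℕ) : Type :=
  Quotient (Relation.EqvGen.setoid fun D E : TangleDiagram m n =>
    Replaces IsotopyMove D E ∨ Replaces FiveTwist D E)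

/-- The class of a tangle diagram. -/
def TangleDiagram.toClass {m n : ℕ} (D : TangleDiagram m n) : TangleClass m n := Quotient.mk _ D

theorem toClass_eq_iff {m n : ℕ} {D E : TangleDiagram m n} :
    D.toClass = E.toClass ↔ FiveMoveEquiv D E :=
  Quotient.eq (r := Relation.EqvGen.setoid _)

theorem Replaces.stack {R : List Event → List Event → Prop} {l m n : ℕ} {D D' : TangleDiagram l m}
    (h : Replaces R D D') (E : TangleDiagram m n) : Replaces R (D.stack E) (D'.stack E) := by
  obtain ⟨u, a, b, v, h, hD, hD'⟩ := h
  exact ⟨u, a, b, v ++ E.word, h, by simp [TangleDiagram.stack, hD],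
    by simp [TangleDiagram.stack, hD']⟩

theorem FiveMoveEquiv.stack {l m n : ℕ} {D D' : TangleDiagram l m} (h : FiveMoveEquiv D D')
    (E : TangleDiagram m n) : FiveMoveEquiv (D.stack E) (D'.stack E) := by
  induction h with
  | rel D D' h => exact .rel _ _ (h.imp (·.stack E) (·.stack E))
  | refl D => exact .refl _
  | symm D D' _ h => exact .symm _ _ h
  | trans D D' D'' _ _ h h' => exact .trans _ _ _ h h'

theorem Isotopic.fiveMoveEquiv {m n : ℕ} {D E : TangleDiagram m n} (h : Isotopic D E) :
    FiveMoveEquiv D E :=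
  Relation.EqvGen.mono (fun _ _ => Or.inl) _ _ h

/-- Stacking a diagram on top of a class of diagrams. -/
def TangleClass.stack {l m n : ℕ} (E : TangleDiagram m n) (x : TangleClass l m) : TangleClass l n :=
  Quotient.liftOn x (fun D => (D.stack E).toClass) fun _ _ h =>
    toClass_eq_iff.mpr (FiveMoveEquiv.stack h E)

theorem toClass_eq_of_isotopyMove {m n : ℕ} {D E : TangleDiagram m n} (u v : List Event)
    {a b : List Event} (h : IsotopyMove a b) (hD : D.word = u ++ a ++ v)
    (hE : E.word = u ++ b ++ v) : D.toClass = E.toClass :=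
  toClass_eq_iff.mpr (.rel _ _ (.inl ⟨u, a, b, v, h, hD, hE⟩))

theorem toClass_eq_of_fiveTwist {m n : ℕ} {D E : TangleDiagram m n} (u v : List Event)
    {a b : List Event} (h : FiveTwist a b) (hD : D.word = u ++ a ++ v)
    (hE : E.word = u ++ b ++ v) : D.toClass = E.toClass :=
  toClass_eq_iff.mpr (.rel _ _ (.inr ⟨u, a, b, v, h, hD, hE⟩))

/-- The half twist of the ends NE and SE, up to 5-moves. -/
def horizontalPerm : Equiv.Perm (TangleClass 0 4) where
  toFun := TangleClass.stack (horizontalTwist true)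
  invFun := TangleClass.stack (horizontalTwist false)
  left_inv x := by
    induction x using Quotient.ind with
    | _ T => exact toClass_eq_of_isotopyMove T.word [] (.reidemeisterTwo false 2)
              (by simp [TangleDiagram.stack, horizontalTwist]) (by simp)
  right_inv x := by
    induction x using Quotient.ind with
    | _ T => exact toClass_eq_of_isotopyMove T.word [] (.reidemeisterTwo true 2)
              (by simp [TangleDiagram.stack, horizontalTwist]) (by simp)

/-- The half twist of the ends NW and NE, up to 5-moves. -/
def verticalPerm : Equiv.Perm (TangleClass 0 4) where
  toFun := TangleClass.stack (verticalTwist true)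
  invFun := TangleClass.stack (verticalTwist false)
  left_inv x := by
    induction x using Quotient.ind with
    | _ T => exact toClass_eq_of_isotopyMove T.word [] (.reidemeisterTwo true 1)
              (by simp [TangleDiagram.stack, verticalTwist]) (by simp)
  right_inv x := by
    induction x using Quotient.ind with
    | _ T => exact toClass_eq_of_isotopyMove T.word [] (.reidemeisterTwo false 1)
              (by simp [TangleDiagram.stack, verticalTwist]) (by simp)

theorem twistRelations : TwistRelations horizontalPerm verticalPerm tangleZero.toClass
    tangleInfinity.toClass where
  braid := by
    ext x
    induction x using Quotient.ind with
    | _ T => exact toClass_eq_of_isotopyMove T.word [] (.reidemeisterThree true 1)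
              (by simp [TangleDiagram.stack, horizontalTwist, verticalTwist])
              (by simp [TangleDiagram.stack, horizontalTwist, verticalTwist])
  h_pow := by
    ext x
    induction x using Quotient.ind with
    | _ T => exact (toClass_eq_of_fiveTwist T.word [] (.twist false 2) (by simp)
              (by simp [TangleDiagram.stack, horizontalTwist, List.replicate])).symm
  h_inf := toClass_eq_of_isotopyMove [cup 0] [] (.reidemeisterOneCup false 2) rfl rfl
  v_zero := toClass_eq_of_isotopyMove [cup 0] [] (.reidemeisterOneCup true 1) rfl rfl
  v_inf := (toClass_eq_of_isotopyMove [cup 0] [] (.turnCup false 1) rfl rfl).symm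
  v_inv_inf := (toClass_eq_of_isotopyMove [cup 0] [] (.turnCup true 1) rfl rfl).symm

/-- The class of the rational tangles of slope `x / y` modulo 5. -/
def rationalClass (x y : ZMod 5) : TangleClass 0 4 :=
  slopePoint horizontalPerm verticalPerm tangleZero.toClass tangleInfinity.toClass x y

/-- Up to 5-moves, a rational tangle depends only on its slope modulo 5. -/
theorem IsRationalTangle.toClass_eq {T : TangleDiagram 0 4} {p q : ℤ}
    (h : IsRationalTangle T p q) :
    ¬((p : ZMod 5) = 0 ∧ (q : ZMod 5) = 0) ∧ T.toClass = rationalClass p q := by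
  induction h with
  | infinity => exact ⟨by decide, rfl⟩
  | zero => exact ⟨by decide, rfl⟩
  | @horizontal T p q s _ ih =>
    obtain ⟨ih0, ih⟩ := ih
    cases s with
    | true =>
      refine ⟨fun h => ih0 (by simpa [sign, h.2] using h), ?_⟩
      change horizontalPerm T.toClass = _
      rw [ih, rationalClass, twistRelations.h_slopePoint]
      simp [rationalClass, sign]
    | false =>
      refine ⟨fun h => ih0 (by simpa [sign, h.2] using h), ?_⟩
      change horizontalPerm⁻¹ T.toClass = _
      rw [Equiv.Perm.inv_eq_iff_eq, ih, rationalClass, rationalClass,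
        twistRelations.h_slopePoint]
      simp [sign]
  | @vertical T p q s _ ih =>
    obtain ⟨ih0, ih⟩ := ih
    cases s with
    | true =>
      refine ⟨fun h => ih0 (by simpa [sign, h.1] using h), ?_⟩
      change verticalPerm T.toClass = _
      rw [ih, rationalClass, twistRelations.v_slopePoint _ _ ih0]
      simp [rationalClass, sign]
    | false =>
      -- For the inverse twist, `v_slopePoint` is applied at the new slope, so its nonvanishing must
      -- be available to the second component.
      refine (and_iff_left_of_imp fun h0 => ?_).mpr
        fun h => ih0 (by simpa [sign, h.1] using h)
      change verticalPerm⁻¹ T.toClass = _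
      rw [Equiv.Perm.inv_eq_iff_eq, ih, rationalClass, rationalClass,
        twistRelations.v_slopePoint _ _ h0]
      simp [sign]

/-! ## Numerators -/

/-- The class of the numerator of a tangle. -/
def numeratorClass (x : TangleClass 0 4) : TangleClass 0 0 :=
  x.stack ⟨[cap 1, cap 0], rfl⟩

/-- The twisted ends NW and NE are joined by the numerator, so the crossing is a Reidemeister I
kink. -/
theorem numeratorClass_vertical (x : TangleClass 0 4) :
    numeratorClass (verticalPerm x) = numeratorClass x := by
  induction x using Quotient.ind with
  | _ T => exact toClass_eq_of_isotopyMove T.word [cap 0] (.reidemeisterOneCap true 1)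
            (by simp [TangleDiagram.stack, verticalTwist]) (by simp [TangleDiagram.stack])

theorem numeratorClass_rationalClass (x y z : ZMod 5) (hx : x ≠ 0) :
    numeratorClass (rationalClass x y) = numeratorClass (rationalClass x z) := by
  have key (k : ℕ) : numeratorClass (rationalClass x y) =
      numeratorClass (rationalClass x (y + k * x)) := by
    induction k with
    | zero => simp
    | succ k ih =>
      rw [ih, ← numeratorClass_vertical, rationalClass,
        twistRelations.v_slopePoint _ _ fun h => hx h.1, rationalClass]
      congr 2
      push_cast
      ring
  -- Since `x ^ 3 = x⁻¹`, this is the number of vertical twists taking `y` to `z`.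
  have h1 : y + (((z - y) * x ^ 3).val : ℕ) * x = z := by
    rw [ZMod.natCast_zmod_val]
    clear key
    revert x y z
    decide
  rw [key ((z - y) * x ^ 3).val, h1]

theorem exchange_caps {n : ℕ} {D E : TangleDiagram 0 n} (u : List Event)
    (hD : D.word = u ++ [cap 2, cap 0]) (hE : E.word = u ++ [cap 0, cap 0]) :
    D.toClass = E.toClass :=
  (toClass_eq_of_isotopyMove u [] (.exchange .cap .cap 0 0 le_rfl) (by simpa) (by simpa)).symm

/-- The circles start nested. A Reidemeister II pair is created, one crossing is turned past the
inner minimum and the other past the inner maximum, and the pair cancels: the inner circle has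
passed through the outer strand's line. -/
theorem numeratorClass_zero :
    numeratorClass tangleZero.toClass = trivialLinkTwo.toClass := by
  let D₁ : LinkDiagram := ⟨[cup 0, cup 1, cross true 2, cross false 2, cap 1, cap 0], rfl⟩
  let D₂ : LinkDiagram := ⟨[cup 0, cup 2, cross false 1, cross false 2, cap 1, cap 0], rfl⟩
  let D₃ : LinkDiagram := ⟨[cup 0, cup 2, cross false 1, cross true 1, cap 2, cap 0], rfl⟩
  let D₄ : LinkDiagram := ⟨[cup 0, cup 2, cap 2, cap 0], rfl⟩
  let D₅ : LinkDiagram := ⟨[cup 0, cup 2, cap 0, cap 0], rfl⟩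
  calc _ = D₁.toClass := (toClass_eq_of_isotopyMove [cup 0, cup 1] [cap 1, cap 0]
        (.reidemeisterTwo true 2) rfl rfl).symm
    _ = D₂.toClass := toClass_eq_of_isotopyMove [cup 0] [cross false 2, cap 1, cap 0]
        (.turnCup true 1) rfl rfl
    _ = D₃.toClass := toClass_eq_of_isotopyMove [cup 0, cup 2, cross false 1] [cap 0]
        (.turnCap false 1) rfl rfl
    _ = D₄.toClass := toClass_eq_of_isotopyMove [cup 0, cup 2] [cap 2, cap 0]
        (.reidemeisterTwo false 1) rfl rfl
    _ = D₅.toClass := exchange_caps [cup 0, cup 2] rfl rfl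
    _ = _ := (toClass_eq_of_isotopyMove [cup 0] [cap 0]
        (.exchange .cap .cup 0 0 le_rfl) rfl rfl).symm

theorem numeratorClass_infinity :
    numeratorClass tangleInfinity.toClass = trivialKnot.toClass :=
  toClass_eq_of_isotopyMove [cup 0] [cap 0] (.zigzagLeft 1) rfl rfl

theorem numeratorClass_two :
    numeratorClass (horizontalPerm (horizontalPerm tangleZero.toClass)) = hopfLink.toClass := by
  let D : LinkDiagram := ⟨[cup 0, cup 2, cross true 1, cross false 2, cap 1, cap 0], rfl⟩
  let E : LinkDiagram := ⟨[cup 0, cup 2, cross true 1, cross true 1, cap 2, cap 0], rfl⟩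
  calc _ = D.toClass :=
        toClass_eq_of_isotopyMove [cup 0] [cross false 2, cap 1, cap 0] (.turnCup false 1) rfl rfl
    _ = E.toClass :=
        toClass_eq_of_isotopyMove [cup 0, cup 2, cross true 1] [cap 0] (.turnCap false 1) rfl rfl
    _ = _ := exchange_caps [cup 0, cup 2, cross true 1, cross true 1] rfl rfl

/-- The diagram of `4₁` is literally the numerator of `1 / 2 + 2 = 5 / 2`. -/
theorem numeratorClass_halfPoint :
    numeratorClass (halfPoint horizontalPerm verticalPerm tangleInfinity.toClass) =
      figureEight.toClass := rfl

/-- A rational link is 5-move equivalent to the link that its type modulo 5 prescribes. -/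
theorem IsRationalLink.toClass_eq {L : LinkDiagram} {p q : ℤ} (h : IsRationalLink L p q) :
    ¬((p : ZMod 5) = 0 ∧ (q : ZMod 5) = 0) ∧
      L.toClass = numeratorClass (rationalClass p q) := by
  obtain ⟨T, hT, hL⟩ := h
  have hL' : L.toClass = numeratorClass T.toClass := toClass_eq_iff.mpr hL.fiveMoveEquiv
  rw [hL']
  rcases hT with hT | hT
  · exact ⟨hT.toClass_eq.1, by rw [hT.toClass_eq.2]⟩
  · obtain ⟨h0, h⟩ := hT.toClass_eq
    rw [h]
    push_cast at h0 ⊢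
    exact ⟨by simpa using h0, congrArg _ (slopePoint_neg _ _)⟩

theorem numeratorClass_rationalClass_eq (x y : ZMod 5) (h0 : ¬(x = 0 ∧ y = 0)) :
    (x = 0 ∧ (y = 1 ∨ y = -1) ∧ numeratorClass (rationalClass x y) = trivialLinkTwo.toClass) ∨
    (x = 0 ∧ (y = 2 ∨ y = -2) ∧ numeratorClass (rationalClass x y) = figureEight.toClass) ∨
    ((x = 1 ∨ x = -1) ∧ numeratorClass (rationalClass x y) = trivialKnot.toClass) ∨
    ((x = 2 ∨ x = -2) ∧ numeratorClass (rationalClass x y) = hopfLink.toClass) := by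
  have cases5 : ∀ z : ZMod 5, z = 0 ∨ z = 1 ∨ z = -1 ∨ z = 2 ∨ z = -2 := by decide
  rcases cases5 x with rfl | rfl | rfl | rfl | rfl
  · rcases cases5 y with rfl | rfl | rfl | rfl | rfl
    · exact absurd ⟨rfl, rfl⟩ h0
    · exact .inl ⟨rfl, .inl rfl, numeratorClass_zero⟩
    · exact .inl ⟨rfl, .inr rfl, numeratorClass_zero⟩
    · exact .inr (.inl ⟨rfl, .inl rfl, numeratorClass_halfPoint⟩)
    · exact .inr (.inl ⟨rfl, .inr rfl, numeratorClass_halfPoint⟩)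
  · exact .inr (.inr (.inl ⟨.inl rfl,
      (numeratorClass_rationalClass 1 y 0 (by decide)).trans numeratorClass_infinity⟩))
  · exact .inr (.inr (.inl ⟨.inr rfl,
      (numeratorClass_rationalClass (-1) y 0 (by decide)).trans numeratorClass_infinity⟩))
  · exact .inr (.inr (.inr ⟨.inl rfl,
      (numeratorClass_rationalClass 2 y 1 (by decide)).trans numeratorClass_two⟩))
  · exact .inr (.inr (.inr ⟨.inr rfl,
      (numeratorClass_rationalClass (-2) y (-1) (by decide)).trans numeratorClass_two⟩))

end FiveMove

/-! ### Conclusion: the four cases are exhaustive, and the invariant makes them exclusive -/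

theorem corollary2p12 (L : FiveMove.LinkDiagram) (p q : ℤ) (hpq : IsCoprime p q)
    (hL : FiveMove.IsRationalLink L p q) :
    (FiveMove.FiveMoveEquiv L FiveMove.trivialLinkTwo ↔
      p ≡ 0 [ZMOD 5] ∧ (q ≡ 1 [ZMOD 5] ∨ q ≡ -1 [ZMOD 5])) ∧
    (FiveMove.FiveMoveEquiv L FiveMove.figureEight ↔
      p ≡ 0 [ZMOD 5] ∧ (q ≡ 2 [ZMOD 5] ∨ q ≡ -2 [ZMOD 5])) ∧
    (FiveMove.FiveMoveEquiv L FiveMove.trivialKnot ↔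
      (p ≡ 1 [ZMOD 5] ∨ p ≡ -1 [ZMOD 5])) ∧
    (FiveMove.FiveMoveEquiv L FiveMove.hopfLink ↔
      (p ≡ 2 [ZMOD 5] ∨ p ≡ -2 [ZMOD 5])) := by
  obtain ⟨h0, hL'⟩ := hL.toClass_eq
  have cast (a b : ℤ) : a ≡ b [ZMOD 5] ↔ (a : ZMod 5) = b :=
    (ZMod.intCast_eq_intCast_iff a b 5).symm
  have hcases := FiveMove.numeratorClass_rationalClass_eq _ _ h0
  rw [← hL'] at hcases
  simp only [FiveMove.toClass_eq_iff] at hcases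
  have i1 := fun h : FiveMove.FiveMoveEquiv L FiveMove.trivialLinkTwo => h.bracketInvariant_eq
  have i2 := fun h : FiveMove.FiveMoveEquiv L FiveMove.figureEight => h.bracketInvariant_eq
  have i3 := fun h : FiveMove.FiveMoveEquiv L FiveMove.trivialKnot => h.bracketInvariant_eq
  have i4 := fun h : FiveMove.FiveMoveEquiv L FiveMove.hopfLink => h.bracketInvariant_eq
  rw [FiveMove.bracketInvariant_trivialLinkTwo] at i1
  rw [FiveMove.bracketInvariant_figureEight] at i2
  rw [FiveMove.bracketInvariant_trivialKnot] at i3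
  rw [FiveMove.bracketInvariant_hopfLink] at i4
  simp only [cast]
  push_cast
  generalize (p : ZMod 5) = x at *
  generalize (q : ZMod 5) = y at *
  have d1 : (225 : ZMod 241) ≠ 0 := by decide
  have d2 : (225 : ZMod 241) ≠ 15 := by decide
  have d3 : (225 : ZMod 241) ≠ 240 := by decide
  have d4 : (15 : ZMod 241) ≠ 0 := by decide
  have d5 : (15 : ZMod 241) ≠ 240 := by decide
  have d6 : (240 : ZMod 241) ≠ 0 := by decide
  have c1 : (0 : ZMod 5) ≠ 1 ∧ (0 : ZMod 5) ≠ -1 ∧ (0 : ZMod 5) ≠ 2 ∧ (0 : ZMod 5) ≠ -2 := by decide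
  have c2 : (1 : ZMod 5) ≠ 2 ∧ (1 : ZMod 5) ≠ -2 ∧ (-1 : ZMod 5) ≠ 2 ∧ (-1 : ZMod 5) ≠ -2 := by
    decide
  grind
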